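/- Let $k\ge 1$, let $F=\mathbb F_{2^k}$ be the field with $2^k$ elements, and let $a\in F$ be nonzero. For a nonzero polynomial $f\in F[x]$ write $f\sim[n_1,\dots,n_t]$ if $f$ factors over $F$ into irreducible polynomials of degrees $n_1,\dots,n_t$ (counted with multiplicity, in any order). (1) If $k$ is even, then $x^5+x+1/a$ has one of the factorization types $[1,1,1,1,1]$, $[1,1,3]$, $[1,2,2]$, $[5]$, and $$\begin{aligned} x^5+x+1/a\sim[1,1,1,1,1]&\iff x(1+x)^5+a\sim[1,1,1,1,1,1],\\ x^5+x+1/a\sim[1,1,3]&\iff x(1+x)^5+a\sim[3,3],\\ x^5+x+1/a\sim[1,2,2]&\iff x(1+x)^5+a\sim[1,1,2,2],\\ x^5+x+1/a\sim[5]&\iff x(1+x)^5+a\sim[1,5]. \end{aligned}$$ (2) If $k$ is odd, then $x^5+x+1/a$ has one of the factorization types $[1,1,1,2]$, $[1,4]$, $[2,3]$, and $$\begin{aligned} x^5+x+1/a\sim[1,1,1,2]&\iff x(1+x)^5+a\sim[2,2,2],\\ x^5+x+1/a\sim[1,4]&\iff x(1+x)^5+a\sim[1,1,4],\\ x^5+x+1/a\sim[2,3]&\iff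 x(1+x)^5+a\sim[6]. \end{aligned}$$ -/

import Mathlib

open Polynomial

/-- `HasFactorizationType f d`, written `f ∼ d` in the literature, says that `f` factors over `F`
into irreducible polynomials whose degrees, counted with multiplicity and without regard to order,
are the members of `d`. The factors are multiplied up to a unit, i.e. a nonzero constant. -/
def HasFactorizationType {F : Type*} [Field F] (f : F[X]) (d : Multiset ℕ) : Prop :=
  ∃ s : Multiset F[X],
    (∀ p ∈ s, Irreducible p) ∧ Associated s.prod f ∧ s.map Polynomial.natDegree = d

/-! Over the fixed field of `φ` (the `q`-power Frobenius, `q = 2 ^ k`), factor degrees are the orbit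
lengths of `φ` on the roots (`hasFactorizationType_iff_orbits`). So it suffices to compare its
permutations of the roots of the two polynomials.

The five quintic roots label the vertices of a pentagon. In characteristic 2 with `e2 = 0`,
complementary pentagons have equal pentagon sums, so there are six sums, permuted by `S₅` through
its exotic transitive action on six points. Each sum `θ` satisfies `θ ^ 6 + θ ^ 4 + θ ^ 2 + 1 = b ^
2 * θ` with `b = 1 / a`. With `θ = u ^ 2` this is the square of `(u + 1) ^ 6 = b * u`, and `u / (u +
1)` is a root of the sextic. Thus the roots of the sextic are permuted like the pentagons, and the
cycle type on five points gives that on six.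

Parity of `k` is parity of the permutation: the cross ratio of four quintic roots is a primitive
cube root of unity `c`, which odd permutations send to `c + 1`. Frobenius fixes `c` exactly when `k`
is even. The seven types on six points are distinct, so uniqueness of factorization gives the
converses. -/

/-! ### Algebraic identities for pentagon sums and cross ratios -/

section
variable {L : Type*} [Field L] [CharP L 2]

/-- The sum of products of neighbours on the pentagon with vertices `x₀, …, x₄`. -/
def pentagonSum (x₀ x₁ x₂ x₃ x₄ : L) : L := x₀ * x₁ + x₁ * x₂ + x₂ * x₃ + x₃ * x₄ + x₄ * x₀

/-- The elementary symmetric functions of the tuple are those of the roots of `X ^ 5 + X + b`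
in characteristic two. -/
structure IsRootTuple (b x₀ x₁ x₂ x₃ x₄ : L) : Prop where
  e1 : x₀ + x₁ + x₂ + x₃ + x₄ = 0
  e2 : x₀ * x₁ + x₀ * x₂ + x₀ * x₃ + x₀ * x₄ + x₁ * x₂ + x₁ * x₃ + x₁ * x₄ + x₂ * x₃ +
    x₂ * x₄ + x₃ * x₄ = 0
  e3 : x₀ * x₁ * x₂ + x₀ * x₁ * x₃ + x₀ * x₁ * x₄ + x₀ * x₂ * x₃ + x₀ * x₂ * x₄ +
    x₀ * x₃ * x₄ + x₁ * x₂ * x₃ + x₁ * x₂ * x₄ + x₁ * x₃ * x₄ + x₂ * x₃ * x₄ = 0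
  e4 : x₀ * x₁ * x₂ * x₃ + x₀ * x₁ * x₂ * x₄ + x₀ * x₁ * x₃ * x₄ + x₀ * x₂ * x₃ * x₄ +
    x₁ * x₂ * x₃ * x₄ = 1
  e5 : x₀ * x₁ * x₂ * x₃ * x₄ = b

theorem pentagonSum_root_normalized (S W E : L) (hE : E = S ^ 3 * (1 + S) ^ 3 + S ^ 4 + (1 + S) ^ 4)
   (hW : W ^ 2 + S * (1 + S) * W + S ^ 5 + (1 + S) ^ 5 = 0)  (θ : L) (hθ : θ = S + S ^ 3 + W) :
   θ ^ 6 + E * θ ^ 4 + E ^ 2 * θ ^ 2 + E ^ 3 = (S ^ 3 * (1 + S) ^ 3) ^ 2 * θ := by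
  -- `θ` is `W` translated by `S + S ^ 3`, so it also satisfies a quadratic with coefficients in
  -- `S`. The sextic relation is then checked modulo this quadratic.
  have h1 : θ ^ 2 = S * (1 + S) * θ + 1 + S + S ^ 3 + S ^ 5 + S ^ 6 := by grind
  subst hE
  clear hW hθ
  grind

/-- The variables describe the pentagon through its reflection fixing vertex `0`: `s`, `p` are the
sum and product of `x₁, x₄`, and `t`, `r` those of `x₂, x₃`. The quadratic for `w` has roots `x₁x₂ +
x₃x₄` and `x₁x₃ + x₂x₄`. Everything is homogeneous, so dividing by powers of `x₀` leaves the single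
parameter `S`, and `E` becomes `x₀⁻⁴`. -/
theorem pentagonSum_root_of_involution (s t w x₀ p r b : L) (hx : x₀ = s + t) (hp : p * x₀ = t ^ 3) (hr : r * x₀ = s ^ 3)
   (hw : w ^ 2 + s * t * w + r * s ^ 2 + p * t ^ 2 = 0) (h4 : p * r + x₀ * (p * t + r * s) = 1)
   (h5 : x₀ * p * r = b) (h0 : x₀ ≠ 0) (θ : L) (hθ : θ = x₀ * s + r + w) :
   θ ^ 6 + θ ^ 4 + θ ^ 2 + 1 = b ^ 2 * θ := by
  obtain ⟨S, rfl⟩ : ∃ S, s = x₀ * S := ⟨s / x₀, by field_simp⟩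
  obtain ⟨W, rfl⟩ : ∃ W, w = x₀ ^ 2 * W := ⟨w / x₀ ^ 2, by field_simp⟩
  obtain rfl : t = x₀ * (1 + S) := by grind
  obtain rfl : p = x₀ ^ 2 * (1 + S) ^ 3 := mul_right_cancel₀ h0 (by linear_combination hp)
  obtain rfl : r = x₀ ^ 2 * S ^ 3 := mul_right_cancel₀ h0 (by linear_combination hr)
  have hW : W ^ 2 + S * (1 + S) * W + S ^ 5 + (1 + S) ^ 5 = 0 :=
    mul_left_cancel₀ (pow_ne_zero 4 h0) (by linear_combination hw)
  have key := pentagonSum_root_normalized S W _ rfl hW _ rfl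
  set E := S ^ 3 * (1 + S) ^ 3 + S ^ 4 + (1 + S) ^ 4 with hE
  have h4' : x₀ ^ 4 * E = 1 := by rw [hE]; linear_combination h4
  have hb : b = x₀ ^ 5 * (S ^ 3 * (1 + S) ^ 3) := by linear_combination -h5
  obtain rfl : θ = x₀ ^ 2 * (S + S ^ 3 + W) := by linear_combination hθ
  generalize S + S ^ 3 + W = θ at *
  rw [hb]
  clear_value E
  linear_combination x₀ ^ 12 * key - θ ^ 4 * x₀ ^ 8 * h4' - θ ^ 2 * x₀ ^ 4 * (x₀ ^ 4 * E + 1) * h4' - (x₀ ^ 8 * E ^ 2 + x₀ ^ 4 * E + 1) * h4'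

theorem IsRootTuple.pentagonSum_root {b x₀ x₁ x₂ x₃ x₄ : L} (h : IsRootTuple b x₀ x₁ x₂ x₃ x₄)
    (h0 : x₀ ≠ 0) :
    pentagonSum x₀ x₁ x₂ x₃ x₄ ^ 6 + pentagonSum x₀ x₁ x₂ x₃ x₄ ^ 4 +
      pentagonSum x₀ x₁ x₂ x₃ x₄ ^ 2 + 1 = b ^ 2 * pentagonSum x₀ x₁ x₂ x₃ x₄ := by
  obtain ⟨e1, e2, e3, e4, e5⟩ := h
  have hx : x₀ = (x₁ + x₄) + (x₂ + x₃) := by grind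
  apply pentagonSum_root_of_involution (x₁ + x₄) (x₂ + x₃) (x₁ * x₂ + x₃ * x₄) x₀ (x₁ * x₄) (x₂ * x₃) b hx _ _ _ _ _ h0
  · simp only [pentagonSum]; ring
  · subst hx
    clear e4 e5 h0
    grind
  · subst hx
    clear e4 e5 h0
    grind
  · subst hx
    clear e4 e5 h0 e2 e3
    grind
  · clear e5 e1 e2 e3
    grind
  · clear e4 e1 e2 e3
    grind

/-- In characteristic 2 the left side is `σ₂² + σ₁σ₃` in the elementary symmetric functions of `x₀,
…, x₃`. Eliminating `x₄ = σ₁` turns `e2` and `e3` into `σ₂ = σ₁²` and `σ₃ = σ₁³`, so it vanishes. -/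
theorem IsRootTuple.cross_ratio {b x₀ x₁ x₂ x₃ x₄ : L} (h : IsRootTuple b x₀ x₁ x₂ x₃ x₄) :
    ((x₀ + x₂) * (x₁ + x₃)) ^ 2 + ((x₀ + x₂) * (x₁ + x₃)) * ((x₀ + x₃) * (x₁ + x₂)) +
      ((x₀ + x₃) * (x₁ + x₂)) ^ 2 = 0 := by
  obtain ⟨e1, e2, e3, e4, e5⟩ := h
  have : x₄ = x₀ + x₁ + x₂ + x₃ := by grind
  subst this
  clear e4 e5
  grind
end

/-! ### Irreducible factors and orbits on roots -/

section orbits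
variable {F L : Type*} [Field F] [Field L] [Algebra F L]

/-- The list `l` is a full orbit of `φ`, in the order in which `φ` runs through it. -/
structure IsOrbit (φ : L → L) (l : List L) : Prop where
  ne_nil : l ≠ []
  nodup : l.Nodup
  map_eq : l.map φ = l.rotate 1

/-- The product of `X - x` over the list `l`. -/
noncomputable def linearProd (l : List L) : L[X] := (l.map fun x => X - C x).prod

theorem linearProd_monic (l : List L) : (linearProd l).Monic := by
  exact monic_multiset_prod_of_monic (l : Multiset L) _ fun x _ => monic_X_sub_C x

theorem natDegree_linearProd (l : List L) : (linearProd l).natDegree = l.length := by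
  induction l with
  | nil => simp [linearProd]
  | cons a l ih =>
    have : linearProd (a :: l) = (X - C a) * linearProd l := by simp [linearProd]
    rw [this, (monic_X_sub_C a).natDegree_mul (linearProd_monic l), ih]
    simp [add_comm]

theorem linearProd_flatten (t : List (List L)) :
    linearProd t.flatten = (t.map linearProd).prod := by
  induction t with
  | nil => simp [linearProd]
  | cons l t ih =>
    rw [List.map_cons, List.prod_cons, ← ih]
    simp [linearProd]

theorem linearProd_perm {l l' : List L} (h : l.Perm l') : linearProd l = linearProd l' :=
  (h.map _).prod_eq

theorem linearProd_dvd {l : List L} (hl : l.Nodup) {p : L[X]} (hp : ∀ x ∈ l, p.IsRoot x)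
    (hp0 : p ≠ 0) : linearProd l ∣ p := by
  have := (Multiset.prod_X_sub_C_dvd_iff_le_roots hp0 (l : Multiset L)).2
    ((Multiset.le_iff_subset (by simpa using hl)).2 fun x hx => by
      rw [mem_roots hp0]; exact hp x (by simpa using hx))
  simpa [linearProd] using this

omit [Field L] in
theorem IsOrbit.iterate_head {φ : L → L} {a : L} {l : List L} (h : IsOrbit φ (a :: l)) :
    ∀ i, ∀ hi : i < (a :: l).length, (a :: l)[i] = φ^[i] a := by
  intro i
  induction i with
  | zero => simp
  | succ i ih =>
    intro hi
    have h1 : ((a :: l).map φ)[i]'(by simp at hi ⊢; omega) = ((a :: l).rotate 1)[i]'(by simp at hi ⊢; omega) := by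
      simp only [h.map_eq]
    rw [List.getElem_map, ih (by omega), List.getElem_rotate] at h1
    rw [Function.iterate_succ_apply', h1]
    congr 1
    exact (Nat.mod_eq_of_lt hi).symm

omit [Field L] in
theorem isOrbit_of_periodic (φ : L → L) (α : L) (h : α ∈ Function.periodicPts φ) :
    IsOrbit φ ((List.range (Function.minimalPeriod φ α)).map fun n => φ^[n] α) where
  ne_nil := by
    have := Function.minimalPeriod_pos_of_mem_periodicPts h
    simp; omega
  nodup := by
    have := Function.nodup_periodicOrbit (f := φ) (x := α)
    simpa [Function.periodicOrbit] using this
  map_eq := by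
    apply List.ext_getElem
    · simp
    · intro i h1 h2
      simp [List.getElem_rotate, Function.iterate_mod_minimalPeriod_eq, ← Function.iterate_succ_apply']

variable (φ : L →ₐ[F] L) (hφ : ∀ y, φ y = y → y ∈ Set.range (algebraMap F L))
include hφ

/-- `φ` only rotates the orbit, so the product has coefficients fixed by `φ` and descends to `F`.
The minimal polynomial of one point vanishes on the whole orbit, hence equals the descended
polynomial. -/
theorem IsOrbit.exists_irreducible {l : List L} (h : IsOrbit φ l) :
    ∃ p : F[X], Irreducible p ∧ p.Monic ∧ p.map (algebraMap F L) = linearProd l := by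
  have hmap : (linearProd l).map (φ : L →+* L) = linearProd l := by
    have : (linearProd l).map (φ : L →+* L) = linearProd (l.map φ) := by
      simp [linearProd, Polynomial.map_list_prod, Function.comp_def]
    rw [this, h.map_eq]
    exact (((l.rotate_perm 1).map _).prod_eq)
  have hlift : linearProd l ∈ lifts (algebraMap F L) := by
    rw [lifts_iff_coeff_lifts]
    intro n
    apply hφ
    conv_rhs => rw [← hmap]
    simp
  obtain ⟨p, hp, hdeg, hmon⟩ := lifts_and_natDegree_eq_and_monic hlift (linearProd_monic l)
  refine ⟨p, ?_, hmon, hp⟩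
  obtain ⟨a, l, rfl⟩ := List.exists_cons_of_ne_nil h.ne_nil
  have ha : aeval a p = 0 := by
    rw [aeval_def, ← eval_map, hp]; simp [linearProd]
  have hint : IsIntegral F a := ⟨p, hmon, by simpa [aeval_def] using ha⟩
  have hdvd : minpoly F a ∣ p := minpoly.dvd F a ha
  have hdvd' : linearProd (a :: l) ∣ (minpoly F a).map (algebraMap F L) := by
    apply linearProd_dvd h.nodup
    · intro x hx
      obtain ⟨i, hi, rfl⟩ := List.getElem_of_mem hx
      rw [h.iterate_head, IsRoot, eval_map, ← aeval_def]
      clear hi hx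
      induction i with
      | zero => simp
      | succ i ih => rw [Function.iterate_succ_apply', aeval_algHom_apply, ih, map_zero]
    · exact ((minpoly.monic hint).map _).ne_zero
  have hle := natDegree_le_of_dvd hdvd' ((minpoly.monic hint).map _).ne_zero
  rw [natDegree_map, ← hdeg] at hle
  have := eq_of_monic_of_dvd_of_natDegree_le (minpoly.monic hint) hmon hdvd hle
  rw [this]
  exact minpoly.irreducible hint

theorem exists_orbit_of_irreducible [IsAlgClosed L] {p : F[X]} (hp : Irreducible p)
    (hmon : p.Monic) : ∃ l : List L, IsOrbit φ l ∧ l.length = p.natDegree ∧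
      p.map (algebraMap F L) = linearProd l := by
  obtain ⟨α, hα⟩ := IsAlgClosed.exists_aeval_eq_zero L p hp.degree_pos.ne'
  have hmem : ∀ n, φ^[n] α ∈ p.rootSet L := by
    intro n
    rw [mem_rootSet]
    refine ⟨hp.ne_zero, ?_⟩
    induction n with
    | zero => simpa
    | succ i ih => rw [Function.iterate_succ_apply', aeval_algHom_apply, ih, map_zero]
  -- The iterates lie in the finite root set, so two coincide; injectivity of `φ` cancels the common
  -- iterate.
  have hper : α ∈ Function.periodicPts φ := by
    obtain ⟨m, n, hmn, he⟩ : ∃ m n, m < n ∧ φ^[m] α = φ^[n] α := by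
      by_contra! hcon
      refine (Set.infinite_of_injective_forall_mem (f := fun n => φ^[n] α) ?_ hmem)
        (p.rootSet_finite L)
      intro m n hmn
      by_contra hne
      rcases lt_or_gt_of_ne hne with h | h
      · exact hcon _ _ h hmn
      · exact hcon _ _ h hmn.symm
    refine Function.mk_mem_periodicPts (n := n - m) (by omega) ?_
    have hinj : Function.Injective φ := (φ : L →+* L).injective
    apply hinj.iterate m
    rw [← Function.iterate_add_apply, show m + (n - m) = n by omega, he]
  have ho := isOrbit_of_periodic φ α hper
  obtain ⟨q, hq, hqm, hqe⟩ := ho.exists_irreducible φ hφ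
  have hqα : aeval α q = 0 := by
    rw [aeval_def, ← eval_map, hqe, linearProd, eval_list_prod, List.prod_eq_zero_iff]
    have := Function.minimalPeriod_pos_of_mem_periodicPts hper
    simp only [List.map_map, List.mem_map, List.mem_range]
    exact ⟨0, this, by simp⟩
  have hpq : p = q := by
    rw [minpoly.eq_of_irreducible_of_monic hp hα hmon,
      minpoly.eq_of_irreducible_of_monic hq hqα hqm]
  refine ⟨_, ho, ?_, hpq ▸ hqe⟩
  rw [← natDegree_linearProd, ← hqe, natDegree_map, hpq]

/-- Factorization types over the fixed field of `φ` are read off from the orbits of `φ` on roots. -/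
theorem hasFactorizationType_iff_orbits [IsAlgClosed L] {f : F[X]} (hf : f.Monic)
    (d : Multiset ℕ) : HasFactorizationType f d ↔ ∃ t : Multiset (List L),
      (∀ l ∈ t, IsOrbit φ l) ∧ t.map List.length = d ∧
        f.map (algebraMap F L) = (t.map linearProd).prod := by
  classical
  constructor
  · rintro ⟨s, hs, ha, rfl⟩
    have h1 : ∀ p ∈ s, ∃ l : List L, IsOrbit φ l ∧ l.length = p.natDegree ∧
        (normalize p).map (algebraMap F L) = linearProd l := by
      intro p hp
      obtain ⟨l, h1, h2, h3⟩ := exists_orbit_of_irreducible φ hφ (p := normalize p)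
        ((associated_normalize p).irreducible (hs p hp)) (monic_normalize (hs p hp).ne_zero)
      exact ⟨l, h1, by
        rw [h2]; exact natDegree_eq_of_degree_eq degree_normalize, h3⟩
    choose! g hg1 hg2 hg3 using h1
    refine ⟨s.map g, ?_, ?_, ?_⟩
    · simpa using hg1
    · rw [Multiset.map_map]; exact Multiset.map_congr rfl hg2
    · rw [Multiset.map_map, show (s.map (linearProd ∘ g)) = _ from
        Multiset.map_congr rfl fun p hp => (hg3 p hp).symm]
      have : f = (s.map normalize).prod := by
        rw [← hf.normalize_eq_self, ← normalize_eq_normalize_iff_associated.2 ha]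
        exact map_multiset_prod normalizeHom s
      rw [this, Polynomial.map_multiset_prod, Multiset.map_map]
      rfl
  · rintro ⟨t, ht, rfl, hft⟩
    have h1 : ∀ l ∈ t, ∃ p : F[X], Irreducible p ∧ p.map (algebraMap F L) = linearProd l := by
      intro l hl
      obtain ⟨p, h1, -, h2⟩ := (ht l hl).exists_irreducible φ hφ
      exact ⟨p, h1, h2⟩
    choose! g hg1 hg2 using h1
    refine ⟨t.map g, by simpa using hg1, ?_, ?_⟩
    · have : (t.map g).prod = f := by
        apply map_injective _ (algebraMap F L).injective
        rw [hft, Polynomial.map_multiset_prod, Multiset.map_map]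
        exact congrArg _ (Multiset.map_congr rfl hg2)
      rw [this]
    · rw [Multiset.map_map]
      refine Multiset.map_congr rfl fun l hl => ?_
      rw [Function.comp_apply, ← natDegree_linearProd, ← hg2 l hl, natDegree_map]

end orbits

/-! ### Uniqueness of factorization types and partitions of five -/

theorem HasFactorizationType.unique {F : Type*} [Field F] {f : F[X]} {d e : Multiset ℕ}
    (hd : HasFactorizationType f d) (he : HasFactorizationType f e) : d = e := by
  obtain ⟨s, hs, hsf, rfl⟩ := hd
  obtain ⟨t, ht, htf, rfl⟩ := he
  have := UniqueFactorizationMonoid.factors_unique hs ht (hsf.trans htf.symm)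
  rw [← Multiset.rel_eq, Multiset.rel_map]
  exact this.mono fun p _ q _ h => natDegree_eq_of_degree_eq (degree_eq_degree_of_associated h)

theorem exists_hasFactorizationType {F : Type*} [Field F] {f : F[X]} (hf : f ≠ 0) :
    ∃ d, HasFactorizationType f d ∧ (∀ n ∈ d, 0 < n) ∧ d.sum = f.natDegree := by
  obtain ⟨s, hs, ha⟩ := WfDvdMonoid.exists_factors f hf
  refine ⟨_, ⟨s, hs, ha, rfl⟩, ?_, ?_⟩
  · simpa using fun p hp => (hs p hp).natDegree_pos
  · rw [← natDegree_multiset_prod s fun h => (hs 0 h).ne_zero rfl]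
    exact natDegree_eq_of_degree_eq (degree_eq_degree_of_associated ha)

theorem Multiset.exists_cons_of_sum_pos {d : Multiset ℕ} (hd : ∀ n ∈ d, 0 < n) (hs : 0 < d.sum) :
    ∃ a e, d = a ::ₘ e ∧ 0 < a ∧ a + e.sum = d.sum ∧ ∀ n ∈ e, 0 < n := by
  obtain ⟨a, ha⟩ := Multiset.exists_mem_of_ne_zero (s := d) (by rintro rfl; simp at hs)
  obtain ⟨e, rfl⟩ := Multiset.exists_cons_of_mem ha
  exact ⟨a, e, rfl, hd a ha, by simp, fun n hn => hd n (Multiset.mem_cons_of_mem hn)⟩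

theorem Multiset.eq_zero_of_sum_eq_zero {d : Multiset ℕ} (hd : ∀ n ∈ d, 0 < n) (hs : d.sum = 0) :
    d = 0 := by
  by_contra h
  obtain ⟨a, ha⟩ := Multiset.exists_mem_of_ne_zero h
  have := Multiset.sum_eq_zero_iff.1 hs a ha
  have := hd a ha
  omega

/-- The first four partitions are cycle types of even permutations, the last three of odd ones. -/
theorem partitions_of_five {d : Multiset ℕ} (hd : ∀ n ∈ d, 0 < n) (hs : d.sum = 5) :
    d ∈ [{1, 1, 1, 1, 1}, {1, 1, 3}, {1, 2, 2}, {5}, {1, 1, 1, 2}, {1, 4}, {2, 3}] := by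
  have step : ∀ {d : Multiset ℕ} (n : ℕ), (∀ n ∈ d, 0 < n) → d.sum = n + 1 →
      ∃ a e, d = a ::ₘ e ∧ 0 < a ∧ a ≤ n + 1 ∧ e.sum = n + 1 - a ∧ ∀ n ∈ e, 0 < n := by
    intro d n hd hs
    obtain ⟨a, e, h1, h2, h3, h4⟩ := Multiset.exists_cons_of_sum_pos hd (by omega)
    exact ⟨a, e, h1, h2, by omega, by omega, h4⟩
  -- Each round removes one part; a goal whose remaining sum is `0` is left unchanged by `try`.
  iterate 5
    all_goals
      try
        obtain ⟨a, e, he, h0, h1, hs', hd'⟩ := step _ hd hs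
        clear hd hs
        subst he
        rename' e => d, hs' => hs, hd' => hd
        interval_cases a <;> (clear h0 h1; simp only [Nat.reduceAdd, Nat.reduceSub] at hs)
  all_goals
    obtain rfl := Multiset.eq_zero_of_sum_eq_zero hd hs
    decide

/-! ### The five roots, their cross ratio, and the six roots of the sextic -/

section
variable {L : Type*} [Field L] [CharP L 2]

namespace IsRootTuple
variable {b x₀ x₁ x₂ x₃ x₄ : L}

omit [CharP L 2] in
theorem rotate (h : IsRootTuple b x₀ x₁ x₂ x₃ x₄) : IsRootTuple b x₁ x₂ x₃ x₄ x₀ :=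
  ⟨by linear_combination h.e1, by linear_combination h.e2, by linear_combination h.e3,
    by linear_combination h.e4, by linear_combination h.e5⟩

omit [CharP L 2] in
theorem swap (h : IsRootTuple b x₀ x₁ x₂ x₃ x₄) : IsRootTuple b x₁ x₀ x₂ x₃ x₄ :=
  ⟨by linear_combination h.e1, by linear_combination h.e2, by linear_combination h.e3,
    by linear_combination h.e4, by linear_combination h.e5⟩

theorem of_eq_linearProd (h : (X ^ 5 + X + C b : L[X]) = linearProd [x₀, x₁, x₂, x₃, x₄]) :
    IsRootTuple b x₀ x₁ x₂ x₃ x₄ := by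
  have hexp : linearProd [x₀, x₁, x₂, x₃, x₄] = X ^ 5 - C (x₀ + x₁ + x₂ + x₃ + x₄) * X ^ 4 +
      C (x₀ * x₁ + x₀ * x₂ + x₀ * x₃ + x₀ * x₄ + x₁ * x₂ + x₁ * x₃ + x₁ * x₄ + x₂ * x₃ +
        x₂ * x₄ + x₃ * x₄) * X ^ 3 -
      C (x₀ * x₁ * x₂ + x₀ * x₁ * x₃ + x₀ * x₁ * x₄ + x₀ * x₂ * x₃ + x₀ * x₂ * x₄ +
        x₀ * x₃ * x₄ + x₁ * x₂ * x₃ + x₁ * x₂ * x₄ + x₁ * x₃ * x₄ + x₂ * x₃ * x₄) * X ^ 2 +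
      C (x₀ * x₁ * x₂ * x₃ + x₀ * x₁ * x₂ * x₄ + x₀ * x₁ * x₃ * x₄ + x₀ * x₂ * x₃ * x₄ +
        x₁ * x₂ * x₃ * x₄) * X - C (x₀ * x₁ * x₂ * x₃ * x₄) := by
    simp only [linearProd, List.map_cons, List.map_nil, List.prod_cons, List.prod_nil, map_add,
      map_mul]
    ring
  rw [hexp] at h
  have h0 := congrArg (fun p => coeff p 0) h
  have h1 := congrArg (fun p => coeff p 1) h
  have h2 := congrArg (fun p => coeff p 2) h
  have h3 := congrArg (fun p => coeff p 3) h
  have h4 := congrArg (fun p => coeff p 4) h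
  simp only [coeff_add, coeff_sub, coeff_C_mul, coeff_X_pow, coeff_X, coeff_C] at h0 h1 h2 h3 h4
  norm_num only [if_true, if_false, mul_zero, mul_one, add_zero, zero_add, sub_zero, zero_sub,
    reduceIte] at h0 h1 h2 h3 h4
  refine ⟨?_, ?_, ?_, h1.symm, ?_⟩ <;> grind

omit [CharP L 2] in
theorem ne_zero (h : IsRootTuple b x₀ x₁ x₂ x₃ x₄) (hb : b ≠ 0) : x₀ ≠ 0 := by
  rintro rfl
  exact hb (by simpa using h.e5.symm)

end IsRootTuple

theorem nodup_of_linearProd_eq {b : L} (hb : b ≠ 0) {l : List L}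
    (h : (X ^ 5 + X + C b : L[X]) = linearProd l) : l.Nodup := by
  have hsep : (X ^ 5 + X + C b : L[X]).Separable := by
    -- For `f = X ^ 5 + X + C b`, `f - X * f'` is `C b - 4 * X ^ 5`, which is the constant `b` in
    -- characteristic 2.
    refine ⟨C b⁻¹, -C b⁻¹ * X, ?_⟩
    have hC : (C b⁻¹ * C b : L[X]) = 1 := by rw [← C_mul, inv_mul_cancel₀ hb, C_1]
    have h2 : (2 : L[X]) = 0 := CharTwo.two_eq_zero
    simp only [derivative_add, derivative_X_pow, derivative_X, derivative_C]
    push_cast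
    simp only [map_ofNat]
    linear_combination hC - 2 * C b⁻¹ * X ^ 5 * h2
  rw [h] at hsep
  have := nodup_roots hsep
  rw [linearProd, ← Multiset.prod_coe, ← Multiset.map_coe, roots_multiset_prod_X_sub_C] at this
  simpa using this

/-- Pentagon sums for representatives of the six pairs of complementary pentagons on five points. -/
def pentagonSums (x₀ x₁ x₂ x₃ x₄ : L) : Fin 6 → L :=
  ![pentagonSum x₀ x₁ x₂ x₃ x₄, pentagonSum x₁ x₀ x₂ x₃ x₄, pentagonSum x₀ x₂ x₁ x₃ x₄,
    pentagonSum x₀ x₁ x₃ x₂ x₄, pentagonSum x₀ x₁ x₂ x₄ x₃, pentagonSum x₄ x₁ x₂ x₃ x₀]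

/-- The cross ratio of four points in characteristic two. -/
noncomputable def crossRatio (x₀ x₁ x₂ x₃ : L) : L :=
  ((x₀ + x₂) * (x₁ + x₃)) / ((x₀ + x₃) * (x₁ + x₂))

omit [CharP L 2] in
theorem crossRatio_comm (x₀ x₁ x₂ x₃ : L) : crossRatio x₁ x₀ x₃ x₂ = crossRatio x₀ x₁ x₂ x₃ := by
  simp only [crossRatio]
  rw [mul_comm (x₁ + x₃), mul_comm (x₁ + x₂)]

section
variable {b x₀ x₁ x₂ x₃ x₄ : L} (h : IsRootTuple b x₀ x₁ x₂ x₃ x₄)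
  (hx : [x₀, x₁, x₂, x₃, x₄].Nodup)
include h hx

theorem IsRootTuple.crossRatio_sq : crossRatio x₀ x₁ x₂ x₃ ^ 2 + crossRatio x₀ x₁ x₂ x₃ + 1 = 0 := by
  have := h.cross_ratio
  have h1 : x₀ + x₃ ≠ 0 := by rw [Ne, CharTwo.add_eq_zero]; simp at hx; tauto
  have h2 : x₁ + x₂ ≠ 0 := by rw [Ne, CharTwo.add_eq_zero]; simp at hx; tauto
  simp only [crossRatio]
  field_simp
  linear_combination this

/-- The transposition inverts the cross ratio `c`, and `c * (c + 1) = 1`. -/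
theorem IsRootTuple.crossRatio_swap : crossRatio x₁ x₀ x₂ x₃ = crossRatio x₀ x₁ x₂ x₃ + 1 := by
  have h1 := h.crossRatio_sq hx
  have h2 : crossRatio x₁ x₀ x₂ x₃ = (crossRatio x₀ x₁ x₂ x₃)⁻¹ := by
    simp only [crossRatio, inv_div]
    rw [mul_comm (x₁ + x₂), mul_comm (x₁ + x₃)]
  rw [h2]
  refine inv_eq_of_mul_eq_one_right ?_
  grind

theorem IsRootTuple.crossRatio_rotate : crossRatio x₁ x₂ x₃ x₀ = crossRatio x₀ x₁ x₂ x₃ + 1 := by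
  have h1 : x₀ + x₃ ≠ 0 := by rw [Ne, CharTwo.add_eq_zero]; simp at hx; tauto
  have h2 : x₁ + x₂ ≠ 0 := by rw [Ne, CharTwo.add_eq_zero]; simp at hx; tauto
  have h3 : x₁ + x₀ ≠ 0 := by rw [Ne, CharTwo.add_eq_zero]; simp at hx; tauto
  have h4 : x₂ + x₃ ≠ 0 := by rw [Ne, CharTwo.add_eq_zero]; simp at hx; tauto
  have := h.cross_ratio
  simp only [crossRatio]
  rw [div_add_one (mul_ne_zero h1 h2), div_eq_div_iff (mul_ne_zero h3 h4) (mul_ne_zero h1 h2)]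
  clear h hx h1 h2 h3 h4
  grind

/-- After replacing one pentagon by its complement if necessary, which is free by `e2`, two
pentagons from different pairs differ in four edges forming a 4-cycle. The difference of their sums
is then `(y₀ + y₁) * (y₂ + y₄)`, nonzero for distinct roots. -/
theorem IsRootTuple.pentagonSums_injective :
    Function.Injective (pentagonSums x₀ x₁ x₂ x₃ x₄) := by
  rw [← List.nodup_ofFn]
  simp only [pentagonSums, List.ofFn_succ, List.ofFn_zero, Matrix.cons_val_zero,
    Matrix.cons_val_succ]
  have key : ∀ {u v y₀ y₁ y₂ y₄ : L}, y₀ ≠ y₁ → y₂ ≠ y₄ → (u = v → (y₀ + y₁) * (y₂ + y₄) = 0) →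
      u ≠ v := by
    intro u v y₀ y₁ y₂ y₄ h1 h2 h3 h4
    rcases mul_eq_zero.1 (h3 h4) with h5 | h5 <;> rw [CharTwo.add_eq_zero] at h5 <;> tauto
  have h2 := h.e2
  clear h
  simp only [List.nodup_cons, List.mem_cons, List.not_mem_nil, or_false, not_or, not_false_eq_true,
    List.nodup_nil, and_true] at hx ⊢
  obtain ⟨⟨h01, h02, h03, h04⟩, ⟨h12, h13, h14⟩, ⟨h23, h24⟩, h34⟩ := hx
  refine ⟨⟨key h01 h24 ?_, key h03 h12 ?_, key h14 h23 ?_, key h02 h34 ?_, key h04 h13 ?_⟩,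
    ⟨key h04 h23 ?_, key h02 h13 ?_, key h03 h14 ?_, key h12 h34 ?_⟩,
    ⟨key h01 h34 ?_, key h13 h24 ?_, key h02 h14 ?_⟩, ⟨key h04 h12 ?_, key h03 h24 ?_⟩,
    key h01 h23 ?_⟩ <;> simp only [pentagonSum] <;> clear h01 h02 h03 h04 h12 h13 h14 h23 h24 h34
  all_goals
    clear key
    grind

end

variable [IsAlgClosed L]

/-- The root of `X * (1 + X) ^ 5 + b⁻¹` attached to the pentagon sum `θ`. -/
noncomputable def resolventRoot (θ : L) : L :=
  (frobeniusEquiv L 2).symm θ / ((frobeniusEquiv L 2).symm θ + 1)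

theorem map_resolventRoot (φ : L →+* L) (θ : L) : φ (resolventRoot θ) = resolventRoot (φ θ) := by
  simp [resolventRoot, RingHom.map_frobeniusEquiv_symm]

theorem sqrt_ne_one {b θ : L} (hb : b ≠ 0)
    (h : θ ^ 6 + θ ^ 4 + θ ^ 2 + 1 = b ^ 2 * θ) : (frobeniusEquiv L 2).symm θ + 1 ≠ 0 := by
  intro h1
  rw [CharTwo.add_eq_zero] at h1
  have h2 : θ = 1 := by
    have := frobeniusEquiv_symm_pow_p L 2 θ
    rw [← this, h1, one_pow]
  rw [h2] at h
  apply hb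
  have : (2 : L) = 0 := CharTwo.two_eq_zero
  refine pow_eq_zero_iff (two_ne_zero) |>.1 ?_
  linear_combination -h + 2 * this

/-- With `u ^ 2 = θ` and `y = u / (u + 1)`, one has `1 + y = 1 / (u + 1)`, so `y * (1 + y) ^ 5 = u /
(u + 1) ^ 6 = b⁻¹`. -/
theorem resolventRoot_root {b θ : L} (hb : b ≠ 0)
    (h : θ ^ 6 + θ ^ 4 + θ ^ 2 + 1 = b ^ 2 * θ) :
    resolventRoot θ * (1 + resolventRoot θ) ^ 5 + b⁻¹ = 0 := by
  have hu := sqrt_ne_one hb h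
  have h2 := frobeniusEquiv_symm_pow_p L 2 θ
  simp only [resolventRoot]
  generalize (frobeniusEquiv L 2).symm θ = u at *
  subst h2
  have h3 : u ^ 6 + u ^ 4 + u ^ 2 + 1 + b * u = 0 := by
    refine pow_eq_zero_iff (two_ne_zero) |>.1 ?_
    simp only [CharTwo.add_sq]
    grind
  have h4 : 1 + u / (u + 1) = 1 / (u + 1) := by
    field_simp
    grind
  rw [h4]
  field_simp
  clear h h4 hb hu
  grind

theorem resolventRoot_inj {b θ η : L} (hb : b ≠ 0)
    (h : θ ^ 6 + θ ^ 4 + θ ^ 2 + 1 = b ^ 2 * θ) (h' : η ^ 6 + η ^ 4 + η ^ 2 + 1 = b ^ 2 * η)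
    (he : resolventRoot θ = resolventRoot η) : θ = η := by
  have hu := sqrt_ne_one hb h
  have hv := sqrt_ne_one hb h'
  apply (frobeniusEquiv L 2).symm.injective
  simp only [resolventRoot] at he
  rw [div_eq_div_iff hu hv] at he
  linear_combination he

section
variable {b x₀ x₁ x₂ x₃ x₄ : L} (h : IsRootTuple b x₀ x₁ x₂ x₃ x₄) (hb : b ≠ 0)
  (hx : [x₀, x₁, x₂, x₃, x₄].Nodup)
include h hb

omit [IsAlgClosed L] in
theorem IsRootTuple.pentagonSums_root (i : Fin 6) :
    pentagonSums x₀ x₁ x₂ x₃ x₄ i ^ 6 + pentagonSums x₀ x₁ x₂ x₃ x₄ i ^ 4 +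
      pentagonSums x₀ x₁ x₂ x₃ x₄ i ^ 2 + 1 = b ^ 2 * pentagonSums x₀ x₁ x₂ x₃ x₄ i := by
  have key : ∀ {y₀ y₁ y₂ y₃ y₄ : L}, IsRootTuple b y₀ y₁ y₂ y₃ y₄ →
      pentagonSum y₀ y₁ y₂ y₃ y₄ ^ 6 + pentagonSum y₀ y₁ y₂ y₃ y₄ ^ 4 +
      pentagonSum y₀ y₁ y₂ y₃ y₄ ^ 2 + 1 = b ^ 2 * pentagonSum y₀ y₁ y₂ y₃ y₄ :=
    fun h => h.pentagonSum_root (h.ne_zero hb)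
  -- The last five pentagons come from the first by transposing two adjacent vertices, that is, by a
  -- conjugate of `swap` under `rotate`.
  fin_cases i
  · exact key h
  · exact key h.swap
  · exact key h.rotate.swap.rotate.rotate.rotate.rotate
  · exact key h.rotate.rotate.swap.rotate.rotate.rotate
  · exact key h.rotate.rotate.rotate.swap.rotate.rotate
  · exact key h.rotate.rotate.rotate.rotate.swap.rotate

include hx

theorem IsRootTuple.resolventRoot_injective :
    Function.Injective fun i => resolventRoot (pentagonSums x₀ x₁ x₂ x₃ x₄ i) := fun i j he =>
  h.pentagonSums_injective hx
    (resolventRoot_inj hb (h.pentagonSums_root hb i) (h.pentagonSums_root hb j) he)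

theorem IsRootTuple.sextic_eq_linearProd : (X * (1 + X) ^ 5 + C b⁻¹ : L[X]) =
    linearProd ((List.finRange 6).map fun i => resolventRoot (pentagonSums x₀ x₁ x₂ x₃ x₄ i)) := by
  have hdeg : (X * (1 + X) ^ 5 + C b⁻¹ : L[X]).natDegree = 6 := by compute_degree!
  have hmon : (X * (1 + X) ^ 5 + C b⁻¹ : L[X]).Monic := by monicity!
  refine eq_of_monic_of_dvd_of_natDegree_le (linearProd_monic _) hmon (linearProd_dvd
    ((List.nodup_finRange 6).map (h.resolventRoot_injective hb hx)) ?_ hmon.ne_zero) ?_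
  · intro y hy
    obtain ⟨i, -, rfl⟩ := List.mem_map.1 hy
    simpa [IsRoot] using resolventRoot_root hb (h.pentagonSums_root hb i)
  · simp [hdeg, natDegree_linearProd]

end
end

/-! ### Orbits listed by prescribed length -/

theorem exists_list_of_map_eq_coe {β γ : Type*} {f : β → γ} {t : Multiset β} {d : List γ}
    (h : t.map f = d) : ∃ u : List β, (u : Multiset β) = t ∧ u.map f = d := by
  classical
  induction d generalizing t with
  | nil => exact ⟨[], (Multiset.map_eq_zero.1 h).symm, rfl⟩
  | cons c d ih =>
    obtain ⟨b, hb, rfl, h2⟩ := (Multiset.map_eq_cons f t d c).2 h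
    obtain ⟨u, hu, rfl⟩ := ih h2
    exact ⟨b :: u, by rw [← Multiset.cons_coe, hu, Multiset.cons_erase hb], rfl⟩

section orbitShapes
variable {α : Type*} {φ : α → α} {l : List α}

theorem IsOrbit.length_one (h : IsOrbit φ l) (hl : l.length = 1) : ∃ a, l = [a] ∧ φ a = a := by
  obtain ⟨a, rfl⟩ := List.length_eq_one_iff.1 hl
  exact ⟨a, rfl, by simpa using h.map_eq⟩

theorem IsOrbit.length_two (h : IsOrbit φ l) (hl : l.length = 2) :
    ∃ a b, l = [a, b] ∧ φ a = b ∧ φ b = a := by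
  obtain ⟨a, b, rfl⟩ := List.length_eq_two.1 hl
  exact ⟨a, b, rfl, by simpa using h.map_eq⟩

theorem IsOrbit.length_three (h : IsOrbit φ l) (hl : l.length = 3) :
    ∃ a b c, l = [a, b, c] ∧ φ a = b ∧ φ b = c ∧ φ c = a := by
  obtain ⟨a, b, c, rfl⟩ := List.length_eq_three.1 hl
  exact ⟨a, b, c, rfl, by simpa using h.map_eq⟩

theorem IsOrbit.length_four (h : IsOrbit φ l) (hl : l.length = 4) :
    ∃ a b c d, l = [a, b, c, d] ∧ φ a = b ∧ φ b = c ∧ φ c = d ∧ φ d = a := by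
  obtain ⟨a, b, c, d, rfl⟩ : ∃ a b c d, l = [a, b, c, d] := by
    match l, hl with
    | [a, b, c, d], _ => exact ⟨a, b, c, d, rfl⟩
  exact ⟨a, b, c, d, rfl, by simpa using h.map_eq⟩

theorem IsOrbit.length_five (h : IsOrbit φ l) (hl : l.length = 5) :
    ∃ a b c d e, l = [a, b, c, d, e] ∧ φ a = b ∧ φ b = c ∧ φ c = d ∧ φ d = e ∧ φ e = a := by
  obtain ⟨a, b, c, d, e, rfl⟩ : ∃ a b c d e, l = [a, b, c, d, e] := by
    match l, hl with
    | [a, b, c, d, e], _ => exact ⟨a, b, c, d, e, rfl⟩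
  exact ⟨a, b, c, d, e, rfl, by simpa using h.map_eq⟩

end orbitShapes

/-! ### The seven cycle types: induced action on pentagons, and parity -/

section
variable {F L : Type*} [Field F] [Field L] [Algebra F L] [CharP L 2] [IsAlgClosed L]
  (φ : L →ₐ[F] L) (hφ : ∀ y, φ y = y → y ∈ Set.range (algebraMap F L))

omit [CharP L 2] [IsAlgClosed L] in
theorem map_pentagonSum (x₀ x₁ x₂ x₃ x₄ : L) : φ (pentagonSum x₀ x₁ x₂ x₃ x₄) =
    pentagonSum (φ x₀) (φ x₁) (φ x₂) (φ x₃) (φ x₄) := by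
  simp [pentagonSum]

omit [CharP L 2] [IsAlgClosed L] in
theorem map_crossRatio (x₀ x₁ x₂ x₃ : L) : φ (crossRatio x₀ x₁ x₂ x₃) =
    crossRatio (φ x₀) (φ x₁) (φ x₂) (φ x₃) := by
  simp [crossRatio]

omit [CharP L 2] [IsAlgClosed L] in
theorem map_pentagonSums (x₀ x₁ x₂ x₃ x₄ : L) (i : Fin 6) : φ (pentagonSums x₀ x₁ x₂ x₃ x₄ i) =
    pentagonSums (φ x₀) (φ x₁) (φ x₂) (φ x₃) (φ x₄) i := by
  fin_cases i <;> exact map_pentagonSum φ ..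

theorem quintic_monic (a : F) : (X ^ 5 + X + C a : F[X]).Monic := by monicity!

theorem sextic_monic (a : F) : (X * (1 + X) ^ 5 + C a : F[X]).Monic := by monicity!

variable {a : F} (ha : a ≠ 0)
include hφ

omit [CharP L 2] in
theorem exists_orbits {f : F[X]} (hf : f.Monic) {d : List ℕ} (hd : HasFactorizationType f d) :
    ∃ t : List (List L), (∀ l ∈ t, IsOrbit φ l) ∧ t.map List.length = d ∧
      f.map (algebraMap F L) = linearProd t.flatten := by
  obtain ⟨t, ht, hlen, hf⟩ := (hasFactorizationType_iff_orbits φ hφ hf _).1 hd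
  obtain ⟨u, rfl, hu⟩ := exists_list_of_map_eq_coe hlen
  refine ⟨u, by simpa using ht, hu, ?_⟩
  rw [hf, Multiset.map_coe, Multiset.prod_coe, linearProd_flatten]

include ha

/-- The action `s` of `φ` on the six pentagon sums determines the factorization type of the sextic. -/
theorem sextic_type {x₀ x₁ x₂ x₃ x₄ : L} (h : IsRootTuple (algebraMap F L a)⁻¹ x₀ x₁ x₂ x₃ x₄)
    (hx : [x₀, x₁, x₂, x₃, x₄].Nodup) (s : Fin 6 → Fin 6)
    (hs : ∀ i, pentagonSums (φ x₀) (φ x₁) (φ x₂) (φ x₃) (φ x₄) i = pentagonSums x₀ x₁ x₂ x₃ x₄ (s i))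
    (t : List (List (Fin 6))) (ht : t.flatten.Perm (List.finRange 6))
    (ht' : ∀ l ∈ t, l ≠ [] ∧ l.map s = l.rotate 1) :
    HasFactorizationType (X * (1 + X) ^ 5 + C a) (t.map List.length : List ℕ) := by
  have hb : (algebraMap F L a)⁻¹ ≠ 0 := by simpa using ha
  have hinj := h.resolventRoot_injective hb hx
  have hg := h.sextic_eq_linearProd hb hx
  set r : Fin 6 → L := fun i => resolventRoot (pentagonSums x₀ x₁ x₂ x₃ x₄ i) with hr
  have hφr : ∀ i, φ (r i) = r (s i) := by
    intro i
    simp only [hr, ← hs i, ← map_pentagonSums]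
    exact map_resolventRoot (φ : L →+* L) _
  have hnd := List.nodup_flatten.1 (ht.nodup_iff.2 (List.nodup_finRange 6))
  refine (hasFactorizationType_iff_orbits φ hφ (sextic_monic _) _).2
    ⟨(t.map (List.map r) : List (List L)), ?_, ?_, ?_⟩
  · intro l hl
    obtain ⟨m, hm, rfl⟩ := List.mem_map.1 (Multiset.mem_coe.1 hl)
    refine ⟨by simpa using (ht' m hm).1, (hnd.1 m hm).map hinj, ?_⟩
    rw [← List.map_rotate, ← (ht' m hm).2]
    simp [hφr]
  · simp [Function.comp_def]
  · rw [Multiset.map_coe, Multiset.prod_coe, ← linearProd_flatten, ← List.map_flatten,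
      linearProd_perm (ht.map r), ← hg]
    simp

omit hφ [IsAlgClosed L] in
theorem isRootTuple_of_map_eq {x₀ x₁ x₂ x₃ x₄ : L}
    (hf : (X ^ 5 + X + C (1 / a) : F[X]).map (algebraMap F L) = linearProd [x₀, x₁, x₂, x₃, x₄]) :
    IsRootTuple (algebraMap F L a)⁻¹ x₀ x₁ x₂ x₃ x₄ ∧ [x₀, x₁, x₂, x₃, x₄].Nodup := by
  have hb : (algebraMap F L a)⁻¹ ≠ 0 := by simpa using ha
  replace hf : (X ^ 5 + X + C (algebraMap F L a)⁻¹ : L[X]) = linearProd [x₀, x₁, x₂, x₃, x₄] := by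
    rw [← hf]; simp
  exact ⟨.of_eq_linearProd hf, nodup_of_linearProd_eq hb hf⟩

theorem sextic_type_of_one_one_one_one_one
    (hd : HasFactorizationType (X ^ 5 + X + C (1 / a)) {1, 1, 1, 1, 1}) :
    HasFactorizationType (X * (1 + X) ^ 5 + C a) {1, 1, 1, 1, 1, 1} ∧
      ¬ ∀ c : L, c ^ 2 + c + 1 = 0 → φ c = c + 1 := by
  obtain ⟨t, ht, hlen, hf⟩ := exists_orbits φ hφ (quintic_monic _) (d := [1, 1, 1, 1, 1]) hd
  simp only [List.map_eq_cons_iff, List.map_eq_nil_iff] at hlen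
  obtain ⟨l₀, _, rfl, hl₀, l₁, _, rfl, hl₁, l₂, _, rfl, hl₂, l₃, _, rfl, hl₃, l₄, _, rfl, hl₄, rfl⟩ := hlen
  obtain ⟨x₀, rfl, h₀⟩ :=
    (ht l₀ (by simp)).length_one hl₀
  obtain ⟨x₁, rfl, h₁⟩ :=
    (ht l₁ (by simp)).length_one hl₁
  obtain ⟨x₂, rfl, h₂⟩ :=
    (ht l₂ (by simp)).length_one hl₂
  obtain ⟨x₃, rfl, h₃⟩ :=
    (ht l₃ (by simp)).length_one hl₃
  obtain ⟨x₄, rfl, h₄⟩ :=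
    (ht l₄ (by simp)).length_one hl₄
  obtain ⟨hroot, hnd⟩ := isRootTuple_of_map_eq ha hf
  constructor
  · have he := hroot.e2
    refine sextic_type φ hφ ha hroot hnd ![0, 1, 2, 3, 4, 5] ?_ [[0], [1], [2], [3], [4], [5]]
      (by decide) (by decide)
    rw [h₀, h₁, h₂, h₃, h₄]
    clear * - he
    intro i
    fin_cases i <;> simp [pentagonSums, pentagonSum]
  · intro hpar
    have hnd' := hnd
    have hc := hpar _ (hroot.crossRatio_sq hnd')
    have hm : φ^[1] (crossRatio x₀ x₁ x₂ x₃) = crossRatio x₀ x₁ x₂ x₃ := by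
      simp only [Function.iterate_succ_apply, Function.iterate_zero_apply, map_crossRatio, h₀, h₁,
        h₂, h₃]
    simp only [Function.iterate_succ_apply, Function.iterate_zero_apply, hc] at hm
    clear * - hm
    grind

theorem sextic_type_of_one_one_three
    (hd : HasFactorizationType (X ^ 5 + X + C (1 / a)) {1, 1, 3}) :
    HasFactorizationType (X * (1 + X) ^ 5 + C a) {3, 3} ∧
      ¬ ∀ c : L, c ^ 2 + c + 1 = 0 → φ c = c + 1 := by
  obtain ⟨t, ht, hlen, hf⟩ := exists_orbits φ hφ (quintic_monic _) (d := [1, 1, 3]) hd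
  simp only [List.map_eq_cons_iff, List.map_eq_nil_iff] at hlen
  obtain ⟨l₀, _, rfl, hl₀, l₁, _, rfl, hl₁, l₂, _, rfl, hl₂, rfl⟩ := hlen
  obtain ⟨x₀, rfl, h₀⟩ :=
    (ht l₀ (by simp)).length_one hl₀
  obtain ⟨x₁, rfl, h₁⟩ :=
    (ht l₁ (by simp)).length_one hl₁
  obtain ⟨x₂, x₃, x₄, rfl, h₂, h₃, h₄⟩ :=
    (ht l₂ (by simp)).length_three hl₂
  obtain ⟨hroot, hnd⟩ := isRootTuple_of_map_eq ha hf
  constructor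
  · have he := hroot.e2
    -- The vector is the permutation of the six pentagon pairs induced by the 3-cycle on `x₂, x₃,
    -- x₄`, and the lists are its cycles. Here `he` identifies a pentagon with its complement.
    refine sextic_type φ hφ ha hroot hnd ![5, 4, 0, 1, 3, 2] ?_ [[0, 5, 2], [1, 4, 3]]
      (by decide) (by decide)
    rw [h₀, h₁, h₂, h₃, h₄]
    clear * - he
    intro i
    fin_cases i <;> simp [pentagonSums, pentagonSum] <;> grind
  · intro hpar
    have hnd' := hnd
    have hc := hpar _ (hroot.crossRatio_sq hnd')
    -- `φ^[3]` fixes all five roots, whereas three shifts by `1` would change the cross ratio.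
    have hm : φ^[3] (crossRatio x₀ x₁ x₂ x₃) = crossRatio x₀ x₁ x₂ x₃ := by
      simp only [Function.iterate_succ_apply, Function.iterate_zero_apply, map_crossRatio, h₀, h₁,
        h₂, h₃, h₄]
    simp only [Function.iterate_succ_apply, Function.iterate_zero_apply, hc, map_add, map_one]
      at hm
    clear * - hm
    grind

theorem sextic_type_of_one_two_two
    (hd : HasFactorizationType (X ^ 5 + X + C (1 / a)) {1, 2, 2}) :
    HasFactorizationType (X * (1 + X) ^ 5 + C a) {1, 1, 2, 2} ∧
      ¬ ∀ c : L, c ^ 2 + c + 1 = 0 → φ c = c + 1 := by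
  obtain ⟨t, ht, hlen, hf⟩ := exists_orbits φ hφ (quintic_monic _) (d := [1, 2, 2]) hd
  simp only [List.map_eq_cons_iff, List.map_eq_nil_iff] at hlen
  obtain ⟨l₀, _, rfl, hl₀, l₁, _, rfl, hl₁, l₂, _, rfl, hl₂, rfl⟩ := hlen
  obtain ⟨x₀, rfl, h₀⟩ :=
    (ht l₀ (by simp)).length_one hl₀
  obtain ⟨x₁, x₂, rfl, h₁, h₂⟩ :=
    (ht l₁ (by simp)).length_two hl₁
  obtain ⟨x₃, x₄, rfl, h₃, h₄⟩ :=
    (ht l₂ (by simp)).length_two hl₂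
  obtain ⟨hroot, hnd⟩ := isRootTuple_of_map_eq ha hf
  constructor
  · have he := hroot.e2
    refine sextic_type φ hφ ha hroot hnd ![3, 1, 4, 0, 2, 5] ?_ [[1], [5], [0, 3], [2, 4]]
      (by decide) (by decide)
    rw [h₀, h₁, h₂, h₃, h₄]
    clear * - he
    intro i
    fin_cases i <;> simp [pentagonSums, pentagonSum] <;> grind
  · intro hpar
    -- Rotating moves the fixed root `x₀` to the end, where the cross ratio omits it. A double
    -- transposition of the other four roots preserves the cross ratio.
    have hnd' := (List.nodup_rotate (n := 1)).2 hnd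
    have hc := hpar _ (hroot.rotate.crossRatio_sq hnd')
    have hm : φ^[1] (crossRatio x₁ x₂ x₃ x₄) = crossRatio x₂ x₁ x₄ x₃ := by
      simp only [Function.iterate_succ_apply, Function.iterate_zero_apply, map_crossRatio, h₀, h₁,
        h₂, h₃, h₄]
    rw [crossRatio_comm x₁ x₂ x₃ x₄] at hm
    simp only [Function.iterate_succ_apply, Function.iterate_zero_apply, hc] at hm
    clear * - hm
    grind

theorem sextic_type_of_five
    (hd : HasFactorizationType (X ^ 5 + X + C (1 / a)) {5}) :
    HasFactorizationType (X * (1 + X) ^ 5 + C a) {1, 5} ∧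
      ¬ ∀ c : L, c ^ 2 + c + 1 = 0 → φ c = c + 1 := by
  obtain ⟨t, ht, hlen, hf⟩ := exists_orbits φ hφ (quintic_monic _) (d := [5]) hd
  simp only [List.map_eq_cons_iff, List.map_eq_nil_iff] at hlen
  obtain ⟨l₀, _, rfl, hl₀, rfl⟩ := hlen
  obtain ⟨x₀, x₁, x₂, x₃, x₄, rfl, h₀, h₁, h₂, h₃, h₄⟩ :=
    (ht l₀ (by simp)).length_five hl₀
  obtain ⟨hroot, hnd⟩ := isRootTuple_of_map_eq ha hf
  constructor
  · have he := hroot.e2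
    refine sextic_type φ hφ ha hroot hnd ![0, 2, 3, 4, 5, 1] ?_ [[0], [1, 2, 3, 4, 5]]
      (by decide) (by decide)
    rw [h₀, h₁, h₂, h₃, h₄]
    clear * - he
    intro i
    fin_cases i <;> simp [pentagonSums, pentagonSum] <;> grind
  · intro hpar
    have hnd' := hnd
    have hc := hpar _ (hroot.crossRatio_sq hnd')
    have hm : φ^[5] (crossRatio x₀ x₁ x₂ x₃) = crossRatio x₀ x₁ x₂ x₃ := by
      simp only [Function.iterate_succ_apply, Function.iterate_zero_apply, map_crossRatio, h₀, h₁,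
        h₂, h₃, h₄]
    simp only [Function.iterate_succ_apply, Function.iterate_zero_apply, hc, map_add, map_one]
      at hm
    clear * - hm
    grind

theorem sextic_type_of_one_one_one_two
    (hd : HasFactorizationType (X ^ 5 + X + C (1 / a)) {1, 1, 1, 2}) :
    HasFactorizationType (X * (1 + X) ^ 5 + C a) {2, 2, 2} ∧
      ¬ ∀ c : L, c ^ 2 + c + 1 = 0 → φ c = c := by
  obtain ⟨t, ht, hlen, hf⟩ := exists_orbits φ hφ (quintic_monic _) (d := [1, 1, 1, 2]) hd
  simp only [List.map_eq_cons_iff, List.map_eq_nil_iff] at hlen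
  obtain ⟨l₀, _, rfl, hl₀, l₁, _, rfl, hl₁, l₂, _, rfl, hl₂, l₃, _, rfl, hl₃, rfl⟩ := hlen
  obtain ⟨x₀, rfl, h₀⟩ :=
    (ht l₀ (by simp)).length_one hl₀
  obtain ⟨x₁, rfl, h₁⟩ :=
    (ht l₁ (by simp)).length_one hl₁
  obtain ⟨x₂, rfl, h₂⟩ :=
    (ht l₂ (by simp)).length_one hl₂
  obtain ⟨x₃, x₄, rfl, h₃, h₄⟩ :=
    (ht l₃ (by simp)).length_two hl₃
  obtain ⟨hroot, hnd⟩ := isRootTuple_of_map_eq ha hf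
  constructor
  · have he := hroot.e2
    refine sextic_type φ hφ ha hroot hnd ![4, 5, 3, 2, 0, 1] ?_ [[0, 4], [1, 5], [2, 3]]
      (by decide) (by decide)
    rw [h₀, h₁, h₂, h₃, h₄]
    clear * - he
    intro i
    fin_cases i <;> simp [pentagonSums, pentagonSum] <;> grind
  · intro hpar
    -- Rotating by three puts the transposed roots `x₃, x₄` in the first two places, as
    -- `crossRatio_swap` needs.
    have hnd' := (List.nodup_rotate (n := 3)).2 hnd
    have hc := hpar _ (hroot.rotate.rotate.rotate.crossRatio_sq hnd')
    have hm : φ^[1] (crossRatio x₃ x₄ x₀ x₁) = crossRatio x₄ x₃ x₀ x₁ := by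
      simp only [Function.iterate_succ_apply, Function.iterate_zero_apply, map_crossRatio, h₀, h₁,
        h₂, h₃, h₄]
    rw [hroot.rotate.rotate.rotate.crossRatio_swap hnd'] at hm
    simp only [Function.iterate_succ_apply, Function.iterate_zero_apply, hc] at hm
    clear * - hm
    grind

theorem sextic_type_of_one_four
    (hd : HasFactorizationType (X ^ 5 + X + C (1 / a)) {1, 4}) :
    HasFactorizationType (X * (1 + X) ^ 5 + C a) {1, 1, 4} ∧
      ¬ ∀ c : L, c ^ 2 + c + 1 = 0 → φ c = c := by
  obtain ⟨t, ht, hlen, hf⟩ := exists_orbits φ hφ (quintic_monic _) (d := [1, 4]) hd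
  simp only [List.map_eq_cons_iff, List.map_eq_nil_iff] at hlen
  obtain ⟨l₀, _, rfl, hl₀, l₁, _, rfl, hl₁, rfl⟩ := hlen
  obtain ⟨x₀, rfl, h₀⟩ :=
    (ht l₀ (by simp)).length_one hl₀
  obtain ⟨x₁, x₂, x₃, x₄, rfl, h₁, h₂, h₃, h₄⟩ :=
    (ht l₁ (by simp)).length_four hl₁
  obtain ⟨hroot, hnd⟩ := isRootTuple_of_map_eq ha hf
  constructor
  · have he := hroot.e2
    refine sextic_type φ hφ ha hroot hnd ![1, 3, 2, 5, 4, 0] ?_ [[2], [4], [0, 1, 3, 5]]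
      (by decide) (by decide)
    rw [h₀, h₁, h₂, h₃, h₄]
    clear * - he
    intro i
    fin_cases i <;> simp [pentagonSums, pentagonSum] <;> grind
  · intro hpar
    have hnd' := (List.nodup_rotate (n := 1)).2 hnd
    have hc := hpar _ (hroot.rotate.crossRatio_sq hnd')
    have hm : φ^[1] (crossRatio x₁ x₂ x₃ x₄) = crossRatio x₂ x₃ x₄ x₁ := by
      simp only [Function.iterate_succ_apply, Function.iterate_zero_apply, map_crossRatio, h₀, h₁,
        h₂, h₃, h₄]
    rw [hroot.rotate.crossRatio_rotate hnd'] at hm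
    simp only [Function.iterate_succ_apply, Function.iterate_zero_apply, hc] at hm
    clear * - hm
    grind

theorem sextic_type_of_two_three
    (hd : HasFactorizationType (X ^ 5 + X + C (1 / a)) {2, 3}) :
    HasFactorizationType (X * (1 + X) ^ 5 + C a) {6} ∧
      ¬ ∀ c : L, c ^ 2 + c + 1 = 0 → φ c = c := by
  obtain ⟨t, ht, hlen, hf⟩ := exists_orbits φ hφ (quintic_monic _) (d := [2, 3]) hd
  simp only [List.map_eq_cons_iff, List.map_eq_nil_iff] at hlen
  obtain ⟨l₀, _, rfl, hl₀, l₁, _, rfl, hl₁, rfl⟩ := hlen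
  obtain ⟨x₀, x₁, rfl, h₀, h₁⟩ :=
    (ht l₀ (by simp)).length_two hl₀
  obtain ⟨x₂, x₃, x₄, rfl, h₂, h₃, h₄⟩ :=
    (ht l₁ (by simp)).length_three hl₁
  obtain ⟨hroot, hnd⟩ := isRootTuple_of_map_eq ha hf
  constructor
  · have he := hroot.e2
    refine sextic_type φ hφ ha hroot hnd ![4, 5, 1, 0, 2, 3] ?_ [[0, 4, 2, 1, 5, 3]]
      (by decide) (by decide)
    rw [h₀, h₁, h₂, h₃, h₄]
    clear * - he
    intro i
    fin_cases i <;> simp [pentagonSums, pentagonSum] <;> grind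
  · intro hpar
    have hnd' := hnd
    have hc := hpar _ (hroot.crossRatio_sq hnd')
    -- Cubing kills the 3-cycle and leaves the transposition of `x₀, x₁`.
    have hm : φ^[3] (crossRatio x₀ x₁ x₂ x₃) = crossRatio x₁ x₀ x₂ x₃ := by
      simp only [Function.iterate_succ_apply, Function.iterate_zero_apply, map_crossRatio, h₀, h₁,
        h₂, h₃, h₄]
    rw [hroot.crossRatio_swap hnd'] at hm
    simp only [Function.iterate_succ_apply, Function.iterate_zero_apply, hc, map_add, map_one]
      at hm
    clear * - hm
    grind

end

/-! ### Frobenius: its fixed field and its action on cube roots of unity -/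

section
variable {F L : Type*} [Field F] [Fintype F] [Field L] [Algebra F L]

/-- Evaluating `X ^ q - X = ∏ (X - a)`, with `a` running over `F` and `q` its cardinality, at a
fixed point `y` gives zero, so `y` equals some `a`. -/
theorem mem_range_algebraMap_of_frobenius_eq {y : L}
    (hy : FiniteField.frobeniusAlgHom F L y = y) : y ∈ Set.range (algebraMap F L) := by
  have hcard := Fintype.one_lt_card (α := F)
  have h := prod_multiset_X_sub_C_of_monic_of_roots_card_eq
    (p := (X ^ Fintype.card F - X : F[X])) (monic_X_pow_sub (by rw [degree_X]; exact_mod_cast hcard))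
    (by
      rw [FiniteField.roots_X_pow_card_sub_X, FiniteField.X_pow_card_sub_X_natDegree_eq F hcard]
      rfl)
  rw [FiniteField.roots_X_pow_card_sub_X] at h
  replace h := congrArg (aeval y) h
  rw [map_multiset_prod, map_sub, map_pow, aeval_X, ← FiniteField.frobeniusAlgHom_apply F L, hy,
    sub_self, Multiset.prod_eq_zero_iff] at h
  simp only [Multiset.map_map, Multiset.mem_map] at h
  obtain ⟨a, -, ha⟩ := h
  exact ⟨a, Eq.symm (by simpa [sub_eq_zero] using ha)⟩

variable [CharP L 2] {k : ℕ} (hF : Fintype.card F = 2 ^ k)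

theorem pow_two_pow_even {c : L} (hc : c ^ 2 + c + 1 = 0) (j : ℕ) : c ^ 2 ^ (2 * j) = c := by
  have h4 : c ^ 4 = c := by grind
  induction j with
  | zero => simp
  | succ j ih => rw [mul_add, pow_add, pow_mul, ih]; exact h4

include hF

theorem frobenius_eq_of_even (hk : Even k) (c : L) (hc : c ^ 2 + c + 1 = 0) :
    FiniteField.frobeniusAlgHom F L c = c := by
  obtain ⟨j, rfl⟩ := hk
  rw [FiniteField.frobeniusAlgHom_apply, hF, ← two_mul, pow_two_pow_even hc]

/-- Since `c ^ 4 = c`, only the parity of `k` matters, and for odd `k` the value is `c ^ 2 = c + 1`.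
-/
theorem frobenius_eq_of_odd (hk : Odd k) (c : L) (hc : c ^ 2 + c + 1 = 0) :
    FiniteField.frobeniusAlgHom F L c = c + 1 := by
  obtain ⟨j, rfl⟩ := hk
  rw [FiniteField.frobeniusAlgHom_apply, hF, pow_succ, pow_mul, pow_two_pow_even hc]
  grind

end

theorem proposition1p1 {F : Type*} [Field F] [Finite F] (k : ℕ) (hF : Nat.card F = 2 ^ k)
    (a : F) (ha : a ≠ 0) :
    (Even k →
      (HasFactorizationType (X ^ 5 + X + C (1 / a)) {1, 1, 1, 1, 1} ∨
        HasFactorizationType (X ^ 5 + X + C (1 / a)) {1, 1, 3} ∨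
        HasFactorizationType (X ^ 5 + X + C (1 / a)) {1, 2, 2} ∨
        HasFactorizationType (X ^ 5 + X + C (1 / a)) {5}) ∧
      (HasFactorizationType (X ^ 5 + X + C (1 / a)) {1, 1, 1, 1, 1} ↔
        HasFactorizationType (X * (1 + X) ^ 5 + C a) {1, 1, 1, 1, 1, 1}) ∧
      (HasFactorizationType (X ^ 5 + X + C (1 / a)) {1, 1, 3} ↔
        HasFactorizationType (X * (1 + X) ^ 5 + C a) {3, 3}) ∧
      (HasFactorizationType (X ^ 5 + X + C (1 / a)) {1, 2, 2} ↔
        HasFactorizationType (X * (1 + X) ^ 5 + C a) {1, 1, 2, 2}) ∧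
      (HasFactorizationType (X ^ 5 + X + C (1 / a)) {5} ↔
        HasFactorizationType (X * (1 + X) ^ 5 + C a) {1, 5})) ∧
    (Odd k →
      (HasFactorizationType (X ^ 5 + X + C (1 / a)) {1, 1, 1, 2} ∨
        HasFactorizationType (X ^ 5 + X + C (1 / a)) {1, 4} ∨
        HasFactorizationType (X ^ 5 + X + C (1 / a)) {2, 3}) ∧
      (HasFactorizationType (X ^ 5 + X + C (1 / a)) {1, 1, 1, 2} ↔
        HasFactorizationType (X * (1 + X) ^ 5 + C a) {2, 2, 2}) ∧
      (HasFactorizationType (X ^ 5 + X + C (1 / a)) {1, 4} ↔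
        HasFactorizationType (X * (1 + X) ^ 5 + C a) {1, 1, 4}) ∧
      (HasFactorizationType (X ^ 5 + X + C (1 / a)) {2, 3} ↔
        HasFactorizationType (X * (1 + X) ^ 5 + C a) {6})) := by
  have := Fintype.ofFinite F
  rw [Nat.card_eq_fintype_card] at hF
  have : CharP F 2 := charP_of_card_eq_prime_pow hF
  let L := AlgebraicClosure F
  have : CharP L 2 := charP_of_injective_algebraMap' F 2
  let φ := FiniteField.frobeniusAlgHom F L
  have hφ : ∀ y, φ y = y → y ∈ Set.range (algebraMap F L) :=
    fun _ => mem_range_algebraMap_of_frobenius_eq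
  have t₁ := sextic_type_of_one_one_one_one_one φ hφ ha
  have t₂ := sextic_type_of_one_one_three φ hφ ha
  have t₃ := sextic_type_of_one_two_two φ hφ ha
  have t₄ := sextic_type_of_five φ hφ ha
  have t₅ := sextic_type_of_one_one_one_two φ hφ ha
  have t₆ := sextic_type_of_one_four φ hφ ha
  have t₇ := sextic_type_of_two_three φ hφ ha
  have hdeg : (X ^ 5 + X + C (1 / a) : F[X]).natDegree = 5 := by compute_degree!
  obtain ⟨d, hd, hpos, hsum⟩ := exists_hasFactorizationType (quintic_monic (1 / a)).ne_zero
  have hmem := partitions_of_five hpos (hsum.trans hdeg)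
  simp only [List.mem_cons, List.not_mem_nil, or_false] at hmem
  constructor
  · intro hk
    have hpar := frobenius_eq_of_even (L := L) hF hk
    refine ⟨?_, ⟨fun h => (t₁ h).1, fun h => ?_⟩, ⟨fun h => (t₂ h).1, fun h => ?_⟩,
      ⟨fun h => (t₃ h).1, fun h => ?_⟩, ⟨fun h => (t₄ h).1, fun h => ?_⟩⟩
    · rcases hmem with rfl | rfl | rfl | rfl | rfl | rfl | rfl
      · exact .inl hd
      · exact .inr (.inl hd)
      · exact .inr (.inr (.inl hd))
      · exact .inr (.inr (.inr hd))
      · exact absurd hpar (t₅ hd).2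
      · exact absurd hpar (t₆ hd).2
      · exact absurd hpar (t₇ hd).2
    -- For the converses, let `d` be the actual type of the quintic. If it differs from the claimed
    -- one, it either has the wrong parity or forces a type of the sextic different from that in
    -- `h`, against uniqueness.
    all_goals
      rcases hmem with rfl | rfl | rfl | rfl | rfl | rfl | rfl
      · first | exact hd | exact absurd (h.unique (t₁ hd).1) (by decide)
      · first | exact hd | exact absurd (h.unique (t₂ hd).1) (by decide)
      · first | exact hd | exact absurd (h.unique (t₃ hd).1) (by decide)
      · first | exact hd | exact absurd (h.unique (t₄ hd).1) (by decide)
      · exact absurd hpar (t₅ hd).2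
      · exact absurd hpar (t₆ hd).2
      · exact absurd hpar (t₇ hd).2
  · intro hk
    have hpar := frobenius_eq_of_odd (L := L) hF hk
    refine ⟨?_, ⟨fun h => (t₅ h).1, fun h => ?_⟩, ⟨fun h => (t₆ h).1, fun h => ?_⟩,
      ⟨fun h => (t₇ h).1, fun h => ?_⟩⟩
    · rcases hmem with rfl | rfl | rfl | rfl | rfl | rfl | rfl
      · exact absurd hpar (t₁ hd).2
      · exact absurd hpar (t₂ hd).2
      · exact absurd hpar (t₃ hd).2
      · exact absurd hpar (t₄ hd).2
      · exact .inl hd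
      · exact .inr (.inl hd)
      · exact .inr (.inr hd)
    all_goals
      rcases hmem with rfl | rfl | rfl | rfl | rfl | rfl | rfl
      · exact absurd hpar (t₁ hd).2
      · exact absurd hpar (t₂ hd).2
      · exact absurd hpar (t₃ hd).2
      · exact absurd hpar (t₄ hd).2
      · first | exact hd | exact absurd (h.unique (t₅ hd).1) (by decide)
      · first | exact hd | exact absurd (h.unique (t₆ hd).1) (by decide)
      · first | exact hd | exact absurd (h.unique (t₇ hd).1) (by decide)
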